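/- Let $\varepsilon>0$ and let $D_\varepsilon=\{(r,z): r>0,\ r^2+z^2<\varepsilon^2\}$. Consider a metric $$ds^2=\sum_{i,j}J_{ij}(r,z)\,dx^i\,dx^j+e^{2\nu(r,z)}(dr^2+dz^2),\qquad (x^0,x^1,x^2)=(t,\varphi,\psi),$$ which solves the reduced Einstein vacuum equations on $D_\varepsilon$: the real $3\times3$ matrix $J$ is symmetric with $\det J=-r^2$, $\nu$ is real-valued and differentiable, and $$\partial_r\big(rJ^{-1}\partial_rJ\big)+\partial_z\big(rJ^{-1}\partial_zJ\big)=0,\qquad \partial_\xi\log\big(re^{2\nu}\big)=\frac{\mathrm i r}{2}\operatorname{tr}\big(J^{-1}J_\xi J^{-1}J_\xi\big),$$ where $\xi=z+\mathrm i r$ and $\partial_\xi=\tfrac12(\partial_z-\mathrm i\,\partial_r)$. Put $r=uv$, $z=\tfrac12(v^2-u^2)$ with $u,v\ge0$. Suppose that $r=z=0$ is a nut at which a rod with $\partial_\varphi=0$ (on $u=0$, $z>0$) meets a rod with $\partial_\psi=0$ (on $v=0$, $z<0$), and that $J$ is regular there: $J$ is also defined on the axis $r=0$, $|z|<\varepsilon$;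 the row and column of $J$ belonging to $\varphi$ vanish for $r=0$, $0<z<\varepsilon$, and those belonging to $\psi$ vanish for $r=0$, $-\varepsilon<z<0$; and the entries of $J$ are smooth functions of the Cartesian coordinates $(u\cos\varphi,u\sin\varphi,v\cos\psi,v\sin\psi)\in\mathbb R^4$ on $u^2+v^2<2\varepsilon$. Conical singularities on the two rods are allowed. Then the factor $(u^2+v^2)e^{2\nu}$ of the $(u,v)$-metric $(u^2+v^2)e^{2\nu}(du^2+dv^2)$ has boundary values on the axis $\{u=0\}\cup\{v=0\}$ near the nut, and as a function of one variable on the axis it is continuous at the nut $u=v=0$. That is, there are $\delta\in(0,\varepsilon]$ and a function $F:\mathbb R\to\mathbb R$, positive and continuous on $(-\delta,\delta)$, in particular at $z=0$, such that for all $z$ with $0<|z|<\delta$ $$F(z)=\lim_{(r,z')\to(0,z),\ r>0}\big(u^2+v^2\big)e^{2\nu}\Big|_{(r,z')}.$$ -/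

import Mathlib

open Filter Topology Matrix
open scoped ContDiff

/-- A `3 × 3` matrix of functions of `(r, z)`; rows and columns `0, 1, 2` belong to the commuting
Killing vectors `∂/∂t, ∂/∂φ, ∂/∂ψ`. -/
abbrev KillingMatrix := ℝ → ℝ → Matrix (Fin 3) (Fin 3) ℝ

/-- Entrywise partial derivative in `r`. -/
noncomputable def partialR (M : KillingMatrix) : KillingMatrix :=
  fun r z => Matrix.of fun i j => deriv (fun s => M s z i j) r

/-- Entrywise partial derivative in `z`. -/
noncomputable def partialZ (M : KillingMatrix) : KillingMatrix :=
  fun r z => Matrix.of fun i j => deriv (fun s => M r s i j) z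

/-- The Wirtinger derivative `∂_ξ = (∂_z - i ∂_r) / 2` for `ξ = z + i r`. -/
noncomputable def dXi (f : ℝ → ℝ → ℝ) (r z : ℝ) : ℂ :=
  (1 / 2 : ℂ) *
    ((deriv (fun s => f r s) z : ℝ) - Complex.I * (deriv (fun s => f s z) r : ℝ))

/-- The matrix `J_ξ`. -/
noncomputable def matDXi (J : KillingMatrix) (r z : ℝ) : Matrix (Fin 3) (Fin 3) ℂ :=
  Matrix.of fun i j => dXi (fun r' z' => J r' z' i j) r z

/-- `J` viewed as a complex matrix. -/
noncomputable def complexify (J : KillingMatrix) (r z : ℝ) : Matrix (Fin 3) (Fin 3) ℂ :=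
  (J r z).map (fun x : ℝ => (x : ℂ))

/-- The open half disc of radius `ε` about the nut `r = z = 0` in the half plane `r > 0`. -/
def halfDisc (ε : ℝ) : Set (ℝ × ℝ) := {p | 0 < p.1 ∧ p.1 ^ 2 + p.2 ^ 2 < ε ^ 2}

/-- The metric `∑ J_ij dx^i dx^j + e^{2ν} (dr² + dz²)`, with `x = (t, φ, ψ)` and `r, z` Weyl
coordinates, solves the (reduced) Einstein vacuum equations on the half disc. -/
structure IsWeylVacuum (ε : ℝ) (J : KillingMatrix) (ν : ℝ → ℝ → ℝ) : Prop where
  symm : ∀ r z, (r, z) ∈ halfDisc ε → (J r z)ᵀ = J r z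
  det_eq : ∀ r z, (r, z) ∈ halfDisc ε → (J r z).det = -r ^ 2
  /-- First part of the field equations: `∂_r (r J⁻¹ J_r) + ∂_z (r J⁻¹ J_z) = 0`. -/
  field_J : ∀ r z, (r, z) ∈ halfDisc ε →
    partialR (fun r' z' => r' • ((J r' z')⁻¹ * partialR J r' z')) r z
      + partialZ (fun r' z' => r' • ((J r' z')⁻¹ * partialZ J r' z')) r z = 0
  differentiable_nu : DifferentiableOn ℝ (fun p : ℝ × ℝ => ν p.1 p.2) (halfDisc ε)
  /-- Second part of the field equations:
  `∂_ξ log (r e^{2ν}) = (i r / 2) tr (J⁻¹ J_ξ J⁻¹ J_ξ)`. -/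
  field_nu : ∀ r z, (r, z) ∈ halfDisc ε →
    dXi (fun r' z' => Real.log (r' * Real.exp (2 * ν r' z'))) r z
      = Complex.I * (r : ℂ) / 2 *
        ((complexify J r z)⁻¹ * matDXi J r z * ((complexify J r z)⁻¹ * matDXi J r z)).trace

/-- `J` is regular at the nut `r = z = 0`, where a rod with `∂/∂φ = 0` (on `z > 0`, i.e. `u = 0`)
meets a rod with `∂/∂ψ = 0` (on `z < 0`, i.e. `v = 0`). Here `r = u v`, `z = (v² - u²) / 2`, and
`(u cos φ, u sin φ, v cos ψ, v sin ψ)` are the Cartesian coordinates near the nut, in which the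
inner products of the Killing vectors have to be smooth. Nothing is required of the conformal
factor, so that conical singularities on the rods are allowed. -/
structure IsRegularNut (ε : ℝ) (J : KillingMatrix) : Prop where
  smooth : ∀ i j, ContDiffOn ℝ ∞
    (fun x : Fin 4 → ℝ =>
      J (√(x 0 ^ 2 + x 1 ^ 2) * √(x 2 ^ 2 + x 3 ^ 2))
        (((x 2 ^ 2 + x 3 ^ 2) - (x 0 ^ 2 + x 1 ^ 2)) / 2) i j)
    {x | x 0 ^ 2 + x 1 ^ 2 + x 2 ^ 2 + x 3 ^ 2 < 2 * ε}
  rod_phi : ∀ z, 0 < z → z < ε → ∀ i, J 0 z i 1 = 0 ∧ J 0 z 1 i = 0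
  rod_psi : ∀ z, -ε < z → z < 0 → ∀ i, J 0 z i 2 = 0 ∧ J 0 z 2 i = 0

/-- The coordinate `u ≥ 0` with `r = u v`, `z = (v² - u²) / 2`. -/
noncomputable def nutU (r z : ℝ) : ℝ := √(-z + √(r ^ 2 + z ^ 2))

/-- The coordinate `v ≥ 0` with `r = u v`, `z = (v² - u²) / 2`. -/
noncomputable def nutV (r z : ℝ) : ℝ := √(z + √(r ^ 2 + z ^ 2))

/-- The factor `(u² + v²) e^{2ν}` for which
`e^{2ν} (dr² + dz²) = (u² + v²) e^{2ν} (du² + dv²)`. -/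
noncomputable def uvFactor (ν : ℝ → ℝ → ℝ) (r z : ℝ) : ℝ :=
  (nutU r z ^ 2 + nutV r z ^ 2) * Real.exp (2 * ν r z)

/-! The logarithm of `(u² + v²) e^{2ν}` has bounded gradient in `(u, v)` on an open square at the
nut. Hence it is Lipschitz there and extends continuously to the closed square, corner included; the
exponential of the extension on the two edges is `F`.

For the gradient bound, the entries of `J` are smooth and even in `u` and `v`, and the rows of `φ`
and `ψ` vanish on `u = 0` and `v = 0`. So `J = E M` with `E = diag(1, u², v²)` and `M` bounded in
`C¹` (`exists_bounds_matrix`). Since `det J = -u²v²`, `det M = -1` and `M⁻¹ = -adj M` is bounded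
too. With `ζ = v + iu` and `∂ = ∂_v - i∂_u = 2∂_ζ`, one has `∂J = E (∂M + D M)`, where `D = diag(0,
-2i/u, 2/v)`. The trace in the equation for `ν` is therefore a multiple of `tr (∂M M⁻¹ + D)²`
(`trace_sq_of_factorization`, `exists_trace_expansion`). Its part `tr D²` contributes exactly `∂ log
(uv / (u² + v²))`, which the definition of `logFactor` removes. The cross terms carry only the
bounded factors `v/ζ` and `u/ζ`, and the last term is bounded as well (`exists_gradient_bound`). -/

/-! ### Taylor bounds for even functions on a square -/

/-- Partial derivative of a function on the plane in the first variable. -/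
noncomputable def partialFst (g : ℝ × ℝ → ℝ) (p : ℝ × ℝ) : ℝ := deriv (fun s => g (s, p.2)) p.1

/-- Partial derivative of a function on the plane in the second variable. -/
noncomputable def partialSnd (g : ℝ × ℝ → ℝ) (p : ℝ × ℝ) : ℝ := deriv (fun s => g (p.1, s)) p.2

lemma hasDerivAt_slice_fst {g : ℝ × ℝ → ℝ} {p : ℝ × ℝ} (hg : DifferentiableAt ℝ g p) :
    HasDerivAt (fun s => g (s, p.2)) (fderiv ℝ g p (1, 0)) p.1 :=
  HasFDerivAt.comp_hasDerivAt (f := fun s : ℝ => (s, p.2)) p.1 hg.hasFDerivAt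
    ((hasDerivAt_id p.1).prodMk (hasDerivAt_const p.1 p.2))

lemma hasDerivAt_slice_snd {g : ℝ × ℝ → ℝ} {p : ℝ × ℝ} (hg : DifferentiableAt ℝ g p) :
    HasDerivAt (fun s => g (p.1, s)) (fderiv ℝ g p (0, 1)) p.2 :=
  HasFDerivAt.comp_hasDerivAt (f := fun s : ℝ => (p.1, s)) p.2 hg.hasFDerivAt
    ((hasDerivAt_const p.2 p.1).prodMk (hasDerivAt_id p.2))

lemma hasDerivAt_partialFst {g : ℝ × ℝ → ℝ} {p : ℝ × ℝ} (hg : DifferentiableAt ℝ g p) :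
    HasDerivAt (fun s => g (s, p.2)) (partialFst g p) p.1 :=
  (hasDerivAt_slice_fst hg).differentiableAt.hasDerivAt

lemma differentiableAt_of_smoothOn {E : Type*} [NormedAddCommGroup E] [NormedSpace ℝ E]
    {g : E → ℝ} {O : Set E} (hO : IsOpen O)
    (hg : ContDiffOn ℝ ∞ g O) {p : E} (hp : p ∈ O) : DifferentiableAt ℝ g p :=
  (hg.differentiableOn (by simp)).differentiableAt (hO.mem_nhds hp)

lemma contDiffOn_partialFst {g : ℝ × ℝ → ℝ} {O : Set (ℝ × ℝ)} (hO : IsOpen O)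
    (hg : ContDiffOn ℝ ∞ g O) : ContDiffOn ℝ ∞ (partialFst g) O :=
  ((hg.fderiv_of_isOpen hO (m := ∞) (by simp)).clm_apply
    (contDiffOn_const (c := ((1, 0) : ℝ × ℝ)))).congr fun _ hp =>
      (hasDerivAt_slice_fst (differentiableAt_of_smoothOn hO hg hp)).deriv

lemma contDiffOn_partialSnd {g : ℝ × ℝ → ℝ} {O : Set (ℝ × ℝ)} (hO : IsOpen O)
    (hg : ContDiffOn ℝ ∞ g O) : ContDiffOn ℝ ∞ (partialSnd g) O :=
  ((hg.fderiv_of_isOpen hO (m := ∞) (by simp)).clm_apply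
    (contDiffOn_const (c := ((0, 1) : ℝ × ℝ)))).congr fun _ hp =>
      (hasDerivAt_slice_snd (differentiableAt_of_smoothOn hO hg hp)).deriv

/-- The closed square `[0, ρ]²`. -/
def cornerSquare (ρ : ℝ) : Set (ℝ × ℝ) := Set.Icc 0 ρ ×ˢ Set.Icc 0 ρ

lemma exists_abs_le_on_cornerSquare {g : ℝ × ℝ → ℝ} {O : Set (ℝ × ℝ)} {ρ : ℝ}
    (hK : cornerSquare ρ ⊆ O) (hg : ContDiffOn ℝ ∞ g O) :
    ∃ C, ∀ p ∈ cornerSquare ρ, |g p| ≤ C :=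
  (isCompact_Icc.prod isCompact_Icc).exists_bound_of_continuousOn (hg.continuousOn.mono hK)

lemma abs_le_mul_of_abs_deriv_le {f f' : ℝ → ℝ} {u B : ℝ} (hu : 0 ≤ u) (h0 : f 0 = 0)
    (hf : ∀ s ∈ Set.Icc 0 u, HasDerivAt f (f' s) s) (hB : ∀ s ∈ Set.Icc 0 u, |f' s| ≤ B) :
    |f u| ≤ B * u := by
  have := (convex_Icc 0 u).norm_image_sub_le_of_norm_hasDerivWithin_le
    (fun s hs => (hf s hs).hasDerivWithinAt) hB (Set.left_mem_Icc.2 hu) (Set.right_mem_Icc.2 hu)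
  simpa [h0, abs_of_nonneg hu] using this

/-- Differentiability is not needed: `deriv_comp_neg` holds unconditionally, and where `f` is not
differentiable `deriv` is `0`. -/
lemma deriv_zero_of_even {f : ℝ → ℝ} (hf : ∀ s, f (-s) = f s) : deriv f 0 = 0 := by
  have h := deriv_comp_neg f 0
  simp only [hf, neg_zero] at h
  linarith

/-- Mean value inequality on the segment from `(0, v)`, where evenness kills the first derivative in
`u`. -/
lemma abs_partialFst_le {g : ℝ × ℝ → ℝ} {O : Set (ℝ × ℝ)} {ρ C : ℝ} (hO : IsOpen O)
    (hK : cornerSquare ρ ⊆ O) (hg : ContDiffOn ℝ ∞ g O) (heven : ∀ u v, g (-u, v) = g (u, v))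
    (hC : ∀ p ∈ cornerSquare ρ, |partialFst (partialFst g) p| ≤ C)
    {p : ℝ × ℝ} (hp : p ∈ cornerSquare ρ) : |partialFst g p| ≤ C * p.1 := by
  obtain ⟨u, v⟩ := p
  have hmem : ∀ s ∈ Set.Icc 0 u, (s, v) ∈ cornerSquare ρ := fun s hs =>
    ⟨⟨hs.1, hs.2.trans hp.1.2⟩, hp.2⟩
  exact abs_le_mul_of_abs_deriv_le (f := fun s => partialFst g (s, v)) hp.1.1
    (deriv_zero_of_even fun s => heven s v)
    (fun s hs => hasDerivAt_partialFst (p := (s, v))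
      (differentiableAt_of_smoothOn hO (contDiffOn_partialFst hO hg) (hK (hmem s hs))))
    (fun s hs => hC _ (hmem s hs))

/-- A smooth function that is even in `u` and vanishes on `u = 0` is `O(u²)`. -/
lemma exists_abs_le_sq {g : ℝ × ℝ → ℝ} {O : Set (ℝ × ℝ)} {ρ : ℝ} (hO : IsOpen O)
    (hK : cornerSquare ρ ⊆ O) (hg : ContDiffOn ℝ ∞ g O) (heven : ∀ u v, g (-u, v) = g (u, v))
    (hzero : ∀ v, 0 < v → v < ρ → g (0, v) = 0) :
    ∃ C, ∀ u v, 0 < u → u < ρ → 0 < v → v < ρ → |g (u, v)| ≤ C * u ^ 2 := by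
  obtain ⟨C, hC⟩ := exists_abs_le_on_cornerSquare hK
    (contDiffOn_partialFst hO (contDiffOn_partialFst hO hg))
  refine ⟨C, fun u v hu hu' hv hv' => ?_⟩
  have hmem : ∀ s ∈ Set.Icc 0 u, (s, v) ∈ cornerSquare ρ := fun s hs =>
    ⟨⟨hs.1, hs.2.trans hu'.le⟩, hv.le, hv'.le⟩
  have hC0 : 0 ≤ C := (abs_nonneg _).trans (hC _ (hmem 0 ⟨le_rfl, hu.le⟩))
  have := abs_le_mul_of_abs_deriv_le (f := fun s => g (s, v)) (B := C * u) hu.le (hzero v hv hv')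
    (fun s hs => hasDerivAt_partialFst (p := (s, v))
      (differentiableAt_of_smoothOn hO hg (hK (hmem s hs))))
    (fun s hs => (abs_partialFst_le hO hK hg heven hC (hmem s hs)).trans
      (mul_le_mul_of_nonneg_left hs.2 hC0))
  linarith

/-- If `g` is smooth, even in `u` and vanishes on `u = 0`, then `u ∂_u g - 2 g` is `O(u³)`. -/
lemma exists_abs_euler_le_cube {g : ℝ × ℝ → ℝ} {O : Set (ℝ × ℝ)} {ρ : ℝ} (hO : IsOpen O)
    (hK : cornerSquare ρ ⊆ O) (hg : ContDiffOn ℝ ∞ g O) (heven : ∀ u v, g (-u, v) = g (u, v))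
    (hzero : ∀ v, 0 < v → v < ρ → g (0, v) = 0) :
    ∃ C, ∀ u v, 0 < u → u < ρ → 0 < v → v < ρ →
      |u * partialFst g (u, v) - 2 * g (u, v)| ≤ C * u ^ 3 := by
  have h1 := contDiffOn_partialFst hO hg
  have h2 := contDiffOn_partialFst hO h1
  obtain ⟨C, hC⟩ := exists_abs_le_on_cornerSquare hK (contDiffOn_partialFst hO h2)
  refine ⟨C, fun u v hu hu' hv hv' => ?_⟩
  have hmem : ∀ s ∈ Set.Icc 0 u, (s, v) ∈ cornerSquare ρ := fun s hs =>
    ⟨⟨hs.1, hs.2.trans hu'.le⟩, hv.le, hv'.le⟩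
  have hC0 : 0 ≤ C := (abs_nonneg _).trans (hC _ (hmem 0 ⟨le_rfl, hu.le⟩))
  have hd0 : ∀ s ∈ Set.Icc 0 u, HasDerivAt (fun s => g (s, v)) (partialFst g (s, v)) s :=
    fun s hs => hasDerivAt_partialFst (p := (s, v))
      (differentiableAt_of_smoothOn hO hg (hK (hmem s hs)))
  have hd1 : ∀ s ∈ Set.Icc 0 u, HasDerivAt (fun s => partialFst g (s, v))
      (partialFst (partialFst g) (s, v)) s :=
    fun s hs => hasDerivAt_partialFst (p := (s, v))
      (differentiableAt_of_smoothOn hO h1 (hK (hmem s hs)))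
  have hd2 : ∀ s ∈ Set.Icc 0 u, HasDerivAt (fun s => partialFst (partialFst g) (s, v))
      (partialFst (partialFst (partialFst g)) (s, v)) s :=
    fun s hs => hasDerivAt_partialFst (p := (s, v))
      (differentiableAt_of_smoothOn hO h2 (hK (hmem s hs)))
  have hg10 : partialFst g (0, v) = 0 := deriv_zero_of_even fun s => heven s v
  -- The derivative of `u g_u - 2g` is `u g_uu - g_u`, whose derivative is `u g_uuu = O(u)`. All
  -- these vanish at `u = 0`, so the mean value inequality applied twice gives `O(u³)`.
  have hm : ∀ t ∈ Set.Icc 0 u,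
      |t * partialFst (partialFst g) (t, v) - partialFst g (t, v)| ≤ C * u * u := by
    intro t ht
    have hsub : ∀ s ∈ Set.Icc 0 t, s ∈ Set.Icc 0 u := fun s hs => ⟨hs.1, hs.2.trans ht.2⟩
    refine (abs_le_mul_of_abs_deriv_le
      (f := fun s => s * partialFst (partialFst g) (s, v) - partialFst g (s, v))
      (f' := fun s => s * partialFst (partialFst (partialFst g)) (s, v)) (B := C * u)
      ht.1 (by simp [hg10]) (fun s hs => ?_) (fun s hs => ?_)).trans
        (mul_le_mul_of_nonneg_left ht.2 (mul_nonneg hC0 hu.le))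
    · exact (((hasDerivAt_id s).mul (hd2 s (hsub s hs))).sub (hd1 s (hsub s hs))).congr_deriv
        (by simp)
    · rw [abs_mul, abs_of_nonneg hs.1, mul_comm]
      exact mul_le_mul (hC _ (hmem s (hsub s hs))) (hsub s hs).2 hs.1 hC0
  have := abs_le_mul_of_abs_deriv_le
    (f := fun s => s * partialFst g (s, v) - 2 * g (s, v))
    (f' := fun s => s * partialFst (partialFst g) (s, v) - partialFst g (s, v)) (B := C * u * u)
    hu.le (by simp [hzero v hv hv'])
    (fun s hs => (((hasDerivAt_id s).mul (hd1 s hs)).sub ((hd0 s hs).const_mul 2)).congr_deriv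
      (by simp; ring)) hm
  calc _ ≤ C * u * u * u := this
    _ = C * u ^ 3 := by ring

/-- If `g` is smooth, even in `u` and vanishes on `u = 0`, then `g / u²` is bounded in `C¹`. -/
lemma exists_bounds_div_sq {g : ℝ × ℝ → ℝ} {O : Set (ℝ × ℝ)} {ρ : ℝ} (hO : IsOpen O)
    (hK : cornerSquare ρ ⊆ O) (hg : ContDiffOn ℝ ∞ g O) (heven : ∀ u v, g (-u, v) = g (u, v))
    (hzero : ∀ v, 0 < v → v < ρ → g (0, v) = 0) :
    ∃ C, ∀ u v, 0 < u → u < ρ → 0 < v → v < ρ →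
      |g (u, v) / u ^ 2| ≤ C ∧
      |partialFst g (u, v) / u ^ 2 - 2 / u * (g (u, v) / u ^ 2)| ≤ C ∧
      |partialSnd g (u, v) / u ^ 2| ≤ C := by
  obtain ⟨C₁, h₁⟩ := exists_abs_le_sq hO hK hg heven hzero
  obtain ⟨C₂, h₂⟩ := exists_abs_euler_le_cube hO hK hg heven hzero
  -- Differentiating along the axis `u = 0` preserves both evenness in `u` and vanishing on the
  -- axis.
  obtain ⟨C₃, h₃⟩ := exists_abs_le_sq hO hK (contDiffOn_partialSnd hO hg)
    (fun u v => by simp only [partialSnd, heven]) (fun v hv hv' => by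
      have : (fun s => g (0, s)) =ᶠ[𝓝 v] fun _ => 0 := by
        filter_upwards [Ioo_mem_nhds hv hv'] with s hs using hzero s hs.1 hs.2
      simp only [partialSnd, this.deriv_eq, deriv_const])
  refine ⟨max C₁ (max C₂ C₃), fun u v hu hu' hv hv' => ⟨?_, ?_, ?_⟩⟩
  · rw [abs_div, abs_of_pos (pow_pos hu 2), div_le_iff₀ (pow_pos hu 2)]
    exact (h₁ u v hu hu' hv hv').trans (by gcongr; exact le_max_left _ _)
  -- The left side is the `u`-derivative of the quotient `g / u²`.
  · have : partialFst g (u, v) / u ^ 2 - 2 / u * (g (u, v) / u ^ 2)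
        = (u * partialFst g (u, v) - 2 * g (u, v)) / u ^ 3 := by field_simp
    rw [this, abs_div, abs_of_pos (pow_pos hu 3), div_le_iff₀ (pow_pos hu 3)]
    exact (h₂ u v hu hu' hv hv').trans
      (by gcongr; exact (le_max_left _ _).trans (le_max_right _ _))
  · rw [abs_div, abs_of_pos (pow_pos hu 2), div_le_iff₀ (pow_pos hu 2)]
    exact (h₃ u v hu hu' hv hv').trans
      (by gcongr; exact (le_max_right _ _).trans (le_max_right _ _))

/-! ### Matrix bounds and the trace of a factorized logarithmic derivative -/

lemma isCompact_matrix_bounded (C : ℝ) :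
    IsCompact {A : Matrix (Fin 3) (Fin 3) ℂ | ∀ i j, ‖A i j‖ ≤ C} := by
  have heq : {A : Matrix (Fin 3) (Fin 3) ℂ | ∀ i j, ‖A i j‖ ≤ C} =
      Set.pi Set.univ fun _ : Fin 3 => Set.pi Set.univ
        fun _ : Fin 3 => Metric.closedBall (0 : ℂ) C :=
    Set.ext fun A => ⟨fun h i _ j _ => mem_closedBall_zero_iff.2 (h i j),
      fun h i j => mem_closedBall_zero_iff.1 (h i trivial j trivial)⟩
  rw [heq]
  exact isCompact_univ_pi fun _ => isCompact_univ_pi fun _ => isCompact_closedBall (0 : ℂ) C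

/-- The products `R * adjugate M` with bounded `M` and `R` are bounded. -/
lemma exists_bound_mul_adjugate (C : ℝ) :
    ∃ B, ∀ M R : Matrix (Fin 3) (Fin 3) ℂ, (∀ i j, ‖M i j‖ ≤ C) → (∀ i j, ‖R i j‖ ≤ C) →
      ‖(R * M.adjugate) 1 1‖ ≤ B ∧ ‖(R * M.adjugate) 2 2‖ ≤ B ∧
      ‖(R * M.adjugate * (R * M.adjugate)).trace‖ ≤ B := by
  have hcont : Continuous fun q : Matrix (Fin 3) (Fin 3) ℂ × Matrix (Fin 3) (Fin 3) ℂ =>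
      q.2 * q.1.adjugate := continuous_snd.matrix_mul continuous_fst.matrix_adjugate
  have hK := (isCompact_matrix_bounded C).prod (isCompact_matrix_bounded C)
  obtain ⟨B₁, h₁⟩ := hK.exists_bound_of_continuousOn (hcont.matrix_elem 1 1).continuousOn
  obtain ⟨B₂, h₂⟩ := hK.exists_bound_of_continuousOn (hcont.matrix_elem 2 2).continuousOn
  obtain ⟨B₃, h₃⟩ := hK.exists_bound_of_continuousOn
    (hcont.matrix_mul hcont).matrix_trace.continuousOn
  refine ⟨max B₁ (max B₂ B₃), fun M R hM hR => ⟨?_, ?_, ?_⟩⟩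
  · exact (h₁ (M, R) ⟨hM, hR⟩).trans (le_max_left _ _)
  · exact (h₂ (M, R) ⟨hM, hR⟩).trans ((le_max_left _ _).trans (le_max_right _ _))
  · exact (h₃ (M, R) ⟨hM, hR⟩).trans ((le_max_right _ _).trans (le_max_right _ _))

/-- Separation of the singular part of `tr (G⁻¹ X G⁻¹ X)` when `G = E M` with `E` diagonal and
`X = E (R + D M)` with `D` diagonal. -/
lemma trace_sq_of_factorization {e d : Fin 3 → ℂ} {M R : Matrix (Fin 3) (Fin 3) ℂ}
    (he : ∀ i, e i ≠ 0) (hM : M.det = -1) (hd : d 0 = 0) :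
    ((diagonal e * M)⁻¹ * (diagonal e * (R + diagonal d * M)) *
      ((diagonal e * M)⁻¹ * (diagonal e * (R + diagonal d * M)))).trace
      = d 1 ^ 2 + d 2 ^ 2 - 2 * (d 1 * (R * M.adjugate) 1 1 + d 2 * (R * M.adjugate) 2 2)
        + (R * M.adjugate * (R * M.adjugate)).trace := by
  have hinv : M⁻¹ = -M.adjugate := by
    rw [inv_def, hM]
    simp [Ring.inverse_eq_inv']
  have hMu : IsUnit M.det := by rw [hM]; exact isUnit_one.neg
  have hEu : IsUnit (diagonal e).det := by
    rw [det_diagonal]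
    exact (Finset.prod_ne_zero_iff.2 fun i _ => he i).isUnit
  have hcancel : (diagonal e * M)⁻¹ * (diagonal e * (R + diagonal d * M))
      = M⁻¹ * (R + diagonal d * M) := by
    rw [Matrix.mul_inv_rev, Matrix.mul_assoc, nonsing_inv_mul_cancel_left _ _ hEu]
  -- The matrix is conjugate under `M` to `R M⁻¹ + D`, and the trace of the square does not see the
  -- conjugation.
  have hconj : M⁻¹ * (R + diagonal d * M) = M⁻¹ * ((R * M⁻¹ + diagonal d) * M) := by
    rw [Matrix.add_mul, Matrix.mul_assoc R, nonsing_inv_mul _ hMu, Matrix.mul_one]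
  have hsq : (M⁻¹ * ((R * M⁻¹ + diagonal d) * M) * (M⁻¹ * ((R * M⁻¹ + diagonal d) * M))).trace
      = ((R * M⁻¹ + diagonal d) * (R * M⁻¹ + diagonal d)).trace := by
    rw [Matrix.mul_assoc, Matrix.trace_mul_comm]
    congr 1
    simp only [Matrix.mul_assoc]
    rw [mul_nonsing_inv_cancel_left _ _ hMu, mul_nonsing_inv _ hMu, Matrix.mul_one]
  rw [hcancel, hconj, hsq, hinv, Matrix.mul_neg]
  generalize R * M.adjugate = Y
  simp only [trace, diag, Matrix.mul_apply, Fin.sum_univ_three, Matrix.add_apply,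
    Matrix.neg_apply, diagonal_apply, hd]
  simp
  ring

/-! ### The coordinates `(u, v)` and the chain rule -/

/-- A function of `(r, z)` in the coordinates `(u, v)`, extended evenly in `u` and `v`. -/
noncomputable def nutPull (f : ℝ → ℝ → ℝ) (p : ℝ × ℝ) : ℝ :=
  f (|p.1| * |p.2|) ((p.2 ^ 2 - p.1 ^ 2) / 2)

/-- The disc `u² + v² < 2 ε`, on which the regularity of the nut is assumed. -/
def nutDisc (ε : ℝ) : Set (ℝ × ℝ) := {p | p.1 ^ 2 + p.2 ^ 2 < 2 * ε}

lemma isOpen_nutDisc (ε : ℝ) : IsOpen (nutDisc ε) :=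
  isOpen_lt (by fun_prop) continuous_const

/-- Restriction of the Cartesian regularity to the plane `(u, 0, v, 0)`, where `√(u²) = |u|`; this
gives smoothness across both axes despite the absolute values. -/
lemma contDiffOn_nutPull {ε : ℝ} {J : KillingMatrix} (hnut : IsRegularNut ε J) (i j : Fin 3) :
    ContDiffOn ℝ ∞ (nutPull fun r z => J r z i j) (nutDisc ε) := by
  have hmap : ContDiff ℝ ∞ fun p : ℝ × ℝ => (![p.1, 0, p.2, 0] : Fin 4 → ℝ) := by
    rw [contDiff_pi]
    intro k
    fin_cases k
    · exact contDiff_fst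
    · exact contDiff_const
    · exact contDiff_snd
    · exact contDiff_const
  refine ((hnut.smooth i j).comp hmap.contDiffOn fun p hp => ?_).congr fun p _ => ?_
  · simpa [nutDisc] using hp
  · simp [nutPull, Real.sqrt_sq_eq_abs]

lemma mul_mem_halfDisc {ε u v : ℝ} (hu : 0 < u) (hv : 0 < v) (h : (u, v) ∈ nutDisc ε) :
    (u * v, (v ^ 2 - u ^ 2) / 2) ∈ halfDisc ε := by
  have h' : u ^ 2 + v ^ 2 < 2 * ε := h
  refine ⟨mul_pos hu hv, ?_⟩
  have h0 : 0 < u ^ 2 + v ^ 2 := by positivity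
  have : (u * v) ^ 2 + ((v ^ 2 - u ^ 2) / 2) ^ 2 = ((u ^ 2 + v ^ 2) / 2) ^ 2 := by ring
  show (u * v) ^ 2 + ((v ^ 2 - u ^ 2) / 2) ^ 2 < ε ^ 2
  rw [this]
  exact pow_lt_pow_left₀ (by linarith) (by positivity) two_ne_zero

lemma abs_le_sqrt_sq_add_sq (r z : ℝ) : |z| ≤ √(r ^ 2 + z ^ 2) :=
  Real.abs_le_sqrt (by nlinarith [sq_nonneg r])

lemma nutU_sq (r z : ℝ) : nutU r z ^ 2 = -z + √(r ^ 2 + z ^ 2) :=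
  Real.sq_sqrt (by linarith [le_abs_self z, abs_le_sqrt_sq_add_sq r z])

lemma nutV_sq (r z : ℝ) : nutV r z ^ 2 = z + √(r ^ 2 + z ^ 2) :=
  Real.sq_sqrt (by linarith [neg_abs_le z, abs_le_sqrt_sq_add_sq r z])

lemma abs_lt_sqrt_of_pos {r : ℝ} (hr : 0 < r) (z : ℝ) : |z| < √(r ^ 2 + z ^ 2) :=
  Real.lt_sqrt_of_sq_lt (by rw [sq_abs]; nlinarith [pow_pos hr 2])

lemma nutU_pos {r : ℝ} (hr : 0 < r) (z : ℝ) : 0 < nutU r z :=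
  Real.sqrt_pos.2 (by linarith [le_abs_self z, abs_lt_sqrt_of_pos hr z])

lemma nutV_pos {r : ℝ} (hr : 0 < r) (z : ℝ) : 0 < nutV r z :=
  Real.sqrt_pos.2 (by linarith [neg_abs_le z, abs_lt_sqrt_of_pos hr z])

lemma nutU_mul_nutV {r : ℝ} (hr : 0 < r) (z : ℝ) : nutU r z * nutV r z = r := by
  have h : (nutU r z * nutV r z) ^ 2 = r ^ 2 := by
    rw [mul_pow, nutU_sq, nutV_sq]
    have := Real.sq_sqrt (show 0 ≤ r ^ 2 + z ^ 2 by positivity)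
    linarith [this]
  exact (pow_left_inj₀ (mul_pos (nutU_pos hr z) (nutV_pos hr z)).le hr.le two_ne_zero).1 h

lemma nutV_sq_sub_nutU_sq (r z : ℝ) : (nutV r z ^ 2 - nutU r z ^ 2) / 2 = z := by
  rw [nutU_sq, nutV_sq]; ring

lemma nutPull_nutU_nutV (f : ℝ → ℝ → ℝ) {r : ℝ} (hr : 0 < r) (z : ℝ) :
    nutPull f (nutU r z, nutV r z) = f r z := by
  simp only [nutPull, abs_of_pos (nutU_pos hr z), abs_of_pos (nutV_pos hr z), nutU_mul_nutV hr,
    nutV_sq_sub_nutU_sq]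

lemma nut_mem_nutDisc {ε r z : ℝ} (hε : 0 < ε) (h : (r, z) ∈ halfDisc ε) :
    (nutU r z, nutV r z) ∈ nutDisc ε := by
  have : √(r ^ 2 + z ^ 2) < ε := (Real.sqrt_lt' hε).2 h.2
  show nutU r z ^ 2 + nutV r z ^ 2 < 2 * ε
  rw [nutU_sq, nutV_sq]; linarith

/-- Off the axis `u` and `v` are differentiable in `(r, z)`, so regularity in `(u, v)` passes back
to the Weyl coordinates, as the chain rule for `J_ξ` requires. -/
lemma differentiableAt_entry {ε : ℝ} {J : KillingMatrix} (hε : 0 < ε) (hnut : IsRegularNut ε J)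
    (i j : Fin 3) {r z : ℝ} (h : (r, z) ∈ halfDisc ε) :
    DifferentiableAt ℝ (fun p : ℝ × ℝ => J p.1 p.2 i j) (r, z) := by
  have hr : 0 < r := h.1
  have hs : r ^ 2 + z ^ 2 ≠ 0 := by positivity
  have hs' : DifferentiableAt ℝ (fun p : ℝ × ℝ => √(p.1 ^ 2 + p.2 ^ 2)) (r, z) :=
    DifferentiableAt.sqrt (by fun_prop) hs
  have hU : DifferentiableAt ℝ (fun p : ℝ × ℝ => nutU p.1 p.2) (r, z) :=
    (differentiableAt_snd.neg.add hs').sqrt (Real.sqrt_pos.1 (nutU_pos hr z)).ne'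
  have hV : DifferentiableAt ℝ (fun p : ℝ × ℝ => nutV p.1 p.2) (r, z) :=
    (differentiableAt_snd.add hs').sqrt (Real.sqrt_pos.1 (nutV_pos hr z)).ne'
  have hG := differentiableAt_of_smoothOn (isOpen_nutDisc ε) (contDiffOn_nutPull hnut i j)
    (nut_mem_nutDisc hε h)
  refine (DifferentiableAt.comp (f := fun p : ℝ × ℝ => (nutU p.1 p.2, nutV p.1 p.2)) (r, z)
    hG (hU.prodMk hV)).congr_of_eventuallyEq ?_
  filter_upwards [continuous_fst.continuousAt.eventually (lt_mem_nhds hr)] with p hp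
  exact (nutPull_nutU_nutV (fun r z => J r z i j) hp p.2).symm

lemma differentiableAt_nutPull {f : ℝ → ℝ → ℝ} {u v : ℝ} (hu : 0 < u) (hv : 0 < v)
    (hf : DifferentiableAt ℝ (fun p : ℝ × ℝ => f p.1 p.2) (u * v, (v ^ 2 - u ^ 2) / 2)) :
    DifferentiableAt ℝ (nutPull f) (u, v) := by
  have hmap : DifferentiableAt ℝ (fun p : ℝ × ℝ => (p.1 * p.2, (p.2 ^ 2 - p.1 ^ 2) / 2)) (u, v) := by
    fun_prop
  refine (DifferentiableAt.comp (u, v) (g := fun p : ℝ × ℝ => f p.1 p.2) hf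
    hmap).congr_of_eventuallyEq ?_
  filter_upwards [continuous_fst.continuousAt.eventually (lt_mem_nhds hu),
    continuous_snd.continuousAt.eventually (lt_mem_nhds hv)] with p hp hp'
  simp [nutPull, abs_of_pos hp, abs_of_pos hp']

/-- The chain rule `∂_ζ = ζ ∂_ξ` for `ξ = ζ² / 2`, `ζ = v + i u`. -/
lemma two_mul_zeta_mul_dXi {f : ℝ → ℝ → ℝ} {u v : ℝ} (hu : 0 < u) (hv : 0 < v)
    (hf : DifferentiableAt ℝ (fun p : ℝ × ℝ => f p.1 p.2) (u * v, (v ^ 2 - u ^ 2) / 2)) :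
    2 * ((v : ℂ) + Complex.I * u) * dXi f (u * v) ((v ^ 2 - u ^ 2) / 2)
      = (partialSnd (nutPull f) (u, v) : ℂ) - Complex.I * (partialFst (nutPull f) (u, v) : ℂ) := by
  set n := fderiv ℝ (fun p : ℝ × ℝ => f p.1 p.2) (u * v, (v ^ 2 - u ^ 2) / 2) with hn
  have hlin : ∀ a b : ℝ, n (a, b) = a * n (1, 0) + b * n (0, 1) := fun a b => by
    rw [← smul_eq_mul, ← smul_eq_mul, ← map_smul, ← map_smul, ← map_add]
    simp
  have hr : deriv (fun s => f s ((v ^ 2 - u ^ 2) / 2)) (u * v) = n (1, 0) :=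
    (hasDerivAt_slice_fst hf).deriv
  have hz : deriv (fun s => f (u * v) s) ((v ^ 2 - u ^ 2) / 2) = n (0, 1) :=
    (hasDerivAt_slice_snd hf).deriv
  have hU : partialFst (nutPull f) (u, v) = v * n (1, 0) - u * n (0, 1) := by
    have h1 : HasDerivAt (fun s : ℝ => (s * v, (v ^ 2 - s ^ 2) / 2)) (v, -u) u :=
      (((hasDerivAt_id u).mul_const v).congr_deriv (by simp)).prodMk
        ((((hasDerivAt_pow 2 u).const_sub (v ^ 2)).div_const 2).congr_deriv (by simp; ring))
    have h2 := HasFDerivAt.comp_hasDerivAt (f := fun s : ℝ => (s * v, (v ^ 2 - s ^ 2) / 2)) u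
      hf.hasFDerivAt h1
    have h3 : (fun s => nutPull f (s, v)) =ᶠ[𝓝 u]
        (fun p : ℝ × ℝ => f p.1 p.2) ∘ fun s : ℝ => (s * v, (v ^ 2 - s ^ 2) / 2) := by
      filter_upwards [lt_mem_nhds hu] with s hs
      simp [nutPull, abs_of_pos hs, abs_of_pos hv]
    rw [partialFst, h3.deriv_eq, h2.deriv, ← hn, hlin]
    ring
  have hV : partialSnd (nutPull f) (u, v) = u * n (1, 0) + v * n (0, 1) := by
    have h1 : HasDerivAt (fun s : ℝ => (u * s, (s ^ 2 - u ^ 2) / 2)) (u, v) v :=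
      (((hasDerivAt_id v).const_mul u).congr_deriv (by simp)).prodMk
        ((((hasDerivAt_pow 2 v).sub_const (u ^ 2)).div_const 2).congr_deriv (by simp))
    have h2 := HasFDerivAt.comp_hasDerivAt (f := fun s : ℝ => (u * s, (s ^ 2 - u ^ 2) / 2)) v
      hf.hasFDerivAt h1
    have h3 : (fun s => nutPull f (u, s)) =ᶠ[𝓝 v]
        (fun p : ℝ × ℝ => f p.1 p.2) ∘ fun s : ℝ => (u * s, (s ^ 2 - u ^ 2) / 2) := by
      filter_upwards [lt_mem_nhds hv] with s hs
      simp [nutPull, abs_of_pos hs, abs_of_pos hu]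
    rw [partialSnd, h3.deriv_eq, h2.deriv, ← hn, hlin]
  rw [hU, hV, dXi, hr, hz]
  push_cast
  linear_combination (-(u : ℂ) * (n (1, 0) : ℂ)) * Complex.I_sq

/-! ### The factorization `J = E M` and the expansion of the trace -/

/-- The orders `1, u², v²` to which the rows of `J` vanish on the rods. -/
def rodScale (u v : ℝ) : Fin 3 → ℝ := ![1, u ^ 2, v ^ 2]

lemma cornerSquare_subset_nutDisc {ε ρ : ℝ} (hρε : ρ ^ 2 < ε) :
    cornerSquare ρ ⊆ nutDisc ε := fun p hp => by
  have h1 : p.1 ^ 2 ≤ ρ ^ 2 := pow_le_pow_left₀ hp.1.1 hp.1.2 2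
  have h2 : p.2 ^ 2 ≤ ρ ^ 2 := pow_le_pow_left₀ hp.2.1 hp.2.2 2
  show p.1 ^ 2 + p.2 ^ 2 < 2 * ε
  linarith

lemma exists_bounds_entry {ε ρ : ℝ} {J : KillingMatrix} (hnut : IsRegularNut ε J)
    (hρε : ρ ^ 2 < ε) (i j : Fin 3) :
    ∃ C, ∀ u v, 0 < u → u < ρ → 0 < v → v < ρ →
      |nutPull (fun r z => J r z i j) (u, v) / rodScale u v i| ≤ C ∧
      |partialFst (nutPull fun r z => J r z i j) (u, v) / rodScale u v i
        - (![0, 2 / u, 0] : Fin 3 → ℝ) i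
          * (nutPull (fun r z => J r z i j) (u, v) / rodScale u v i)| ≤ C ∧
      |partialSnd (nutPull fun r z => J r z i j) (u, v) / rodScale u v i
        - (![0, 0, 2 / v] : Fin 3 → ℝ) i
          * (nutPull (fun r z => J r z i j) (u, v) / rodScale u v i)| ≤ C := by
  have hO := isOpen_nutDisc ε
  have hK := cornerSquare_subset_nutDisc hρε
  have hg := contDiffOn_nutPull hnut i j
  have hsq : ∀ s, 0 < s → s < ρ → s ^ 2 / 2 < ε := fun s h h' => by
    nlinarith [pow_lt_pow_left₀ h' h.le two_ne_zero, pow_pos h 2]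
  fin_cases i
  · obtain ⟨C₁, h₁⟩ := exists_abs_le_on_cornerSquare hK hg
    obtain ⟨C₂, h₂⟩ := exists_abs_le_on_cornerSquare hK (contDiffOn_partialFst hO hg)
    obtain ⟨C₃, h₃⟩ := exists_abs_le_on_cornerSquare hK (contDiffOn_partialSnd hO hg)
    refine ⟨max C₁ (max C₂ C₃), fun u v hu hu' hv hv' => ?_⟩
    have hp : (u, v) ∈ cornerSquare ρ := ⟨⟨hu.le, hu'.le⟩, hv.le, hv'.le⟩
    -- `simp` turns each bound by the iterated maximum into a disjunction, hence the `Or` terms.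
    simpa [rodScale] using And.intro (Or.inl (h₁ _ hp))
      (And.intro (Or.inr (Or.inl (h₂ _ hp))) (Or.inr (Or.inr (h₃ _ hp))))
  · obtain ⟨C, hC⟩ := exists_bounds_div_sq hO hK hg
      (fun u v => by simp only [nutPull, abs_neg, neg_sq])
      (fun v hv hv' => by
        simpa [nutPull] using (hnut.rod_phi (v ^ 2 / 2) (by positivity) (hsq v hv hv') j).2)
    refine ⟨C, fun u v hu hu' hv hv' => ?_⟩
    simpa [rodScale] using hC u v hu hu' hv hv'
  · have hswap : ContDiffOn ℝ ∞ ((nutPull fun r z => J r z 2 j) ∘ Prod.swap) (nutDisc ε) := by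
      refine hg.comp (contDiff_snd.prodMk contDiff_fst).contDiffOn fun p hp => ?_
      have hp' : p.1 ^ 2 + p.2 ^ 2 < 2 * ε := hp
      show p.2 ^ 2 + p.1 ^ 2 < 2 * ε
      linarith
    obtain ⟨C, hC⟩ := exists_bounds_div_sq hO hK hswap
      (fun u v => by simp only [nutPull, Function.comp, Prod.swap, abs_neg, neg_sq])
      (fun v hv hv' => by
        have hv2 : 0 < v ^ 2 := by positivity
        simpa [nutPull] using
          (hnut.rod_psi (-v ^ 2 / 2) (by linarith [hsq v hv hv']) (by linarith) j).2)
    refine ⟨C, fun u v hu hu' hv hv' => ?_⟩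
    obtain ⟨h₁, h₂, h₃⟩ := hC v u hv hv' hu hu'
    refine ⟨h₁, ?_, h₂⟩
    -- The partial derivatives of the swapped function are, by unfolding, those of the original one
    -- interchanged.
    have h₃' : |partialFst (nutPull fun r z => J r z 2 j) (u, v) / v ^ 2| ≤ C := h₃
    simpa [rodScale] using h₃'

lemma exists_bounds_matrix {ε ρ : ℝ} {J : KillingMatrix} (hnut : IsRegularNut ε J)
    (hρε : ρ ^ 2 < ε) :
    ∃ C, ∀ u v, 0 < u → u < ρ → 0 < v → v < ρ → ∀ i j,
      |nutPull (fun r z => J r z i j) (u, v) / rodScale u v i| ≤ C ∧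
      |partialFst (nutPull fun r z => J r z i j) (u, v) / rodScale u v i
        - (![0, 2 / u, 0] : Fin 3 → ℝ) i
          * (nutPull (fun r z => J r z i j) (u, v) / rodScale u v i)| ≤ C ∧
      |partialSnd (nutPull fun r z => J r z i j) (u, v) / rodScale u v i
        - (![0, 0, 2 / v] : Fin 3 → ℝ) i
          * (nutPull (fun r z => J r z i j) (u, v) / rodScale u v i)| ≤ C := by
  choose C hC using exists_bounds_entry hnut hρε
  obtain ⟨D, hD⟩ := (Set.finite_range fun q : Fin 3 × Fin 3 => C q.1 q.2).bddAbove
  refine ⟨D, fun u v hu hu' hv hv' i j => ?_⟩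
  have hCD : C i j ≤ D := hD ⟨(i, j), rfl⟩
  obtain ⟨h₁, h₂, h₃⟩ := hC i j u v hu hu' hv hv'
  exact ⟨h₁.trans hCD, h₂.trans hCD, h₃.trans hCD⟩

/-- The trace in the equation for `ν`, in the coordinates `(u, v)`, is explicitly singular up to
terms controlled by a bounded matrix. -/
lemma exists_trace_expansion {ε ρ : ℝ} (hε : 0 < ε) {J : KillingMatrix} {ν : ℝ → ℝ → ℝ}
    (hvac : IsWeylVacuum ε J ν) (hnut : IsRegularNut ε J) (hρε : ρ ^ 2 < ε) :
    ∃ B, ∀ u v, 0 < u → u < ρ → 0 < v → v < ρ → ∃ a b c : ℂ, ‖a‖ ≤ B ∧ ‖b‖ ≤ B ∧ ‖c‖ ≤ B ∧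
      ((complexify J (u * v) ((v ^ 2 - u ^ 2) / 2))⁻¹ * matDXi J (u * v) ((v ^ 2 - u ^ 2) / 2) *
        ((complexify J (u * v) ((v ^ 2 - u ^ 2) / 2))⁻¹ *
          matDXi J (u * v) ((v ^ 2 - u ^ 2) / 2))).trace
        = (1 / (2 * ((v : ℂ) + Complex.I * u))) ^ 2 *
          ((-(Complex.I * (2 / u))) ^ 2 + (2 / v) ^ 2
            - 2 * (-(Complex.I * (2 / u)) * a + 2 / v * b) + c) := by
  obtain ⟨C, hC⟩ := exists_bounds_matrix hnut hρε
  -- `C` bounds the entries of `M`; `C + C` bounds those of `R`, through real and imaginary parts.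
  obtain ⟨B, hB⟩ := exists_bound_mul_adjugate (max C (C + C))
  refine ⟨B, fun u v hu hu' hv hv' => ?_⟩
  have hmem : (u, v) ∈ nutDisc ε :=
    cornerSquare_subset_nutDisc hρε ⟨⟨hu.le, hu'.le⟩, hv.le, hv'.le⟩
  have hhalf := mul_mem_halfDisc hu hv hmem
  have hζ : (v : ℂ) + Complex.I * u ≠ 0 := fun h => hv.ne' (by simpa using congrArg Complex.re h)
  let g : Fin 3 → Fin 3 → ℝ × ℝ → ℝ := fun i j => nutPull fun r z => J r z i j
  let e : Fin 3 → ℂ := fun i => (rodScale u v i : ℂ)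
  -- `d` is the logarithmic derivative of `e` under `∂_v - i∂_u`, and `R` below is `(∂_v - i∂_u) M`.
  let d : Fin 3 → ℂ := fun i => (((![0, 0, 2 / v] : Fin 3 → ℝ) i : ℝ) : ℂ)
    - Complex.I * (((![0, 2 / u, 0] : Fin 3 → ℝ) i : ℝ) : ℂ)
  let M : Matrix (Fin 3) (Fin 3) ℂ := Matrix.of fun i j => ((g i j (u, v) / rodScale u v i : ℝ) : ℂ)
  let R : Matrix (Fin 3) (Fin 3) ℂ := Matrix.of fun i j =>
    ((partialSnd (g i j) (u, v) / rodScale u v i - (![0, 0, 2 / v] : Fin 3 → ℝ) i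
      * (g i j (u, v) / rodScale u v i) : ℝ) : ℂ)
    - Complex.I * ((partialFst (g i j) (u, v) / rodScale u v i - (![0, 2 / u, 0] : Fin 3 → ℝ) i
      * (g i j (u, v) / rodScale u v i) : ℝ) : ℂ)
  have he : ∀ i, e i ≠ 0 := by
    intro i
    fin_cases i <;> simp [e, rodScale, hu.ne', hv.ne']
  have hJ : complexify J (u * v) ((v ^ 2 - u ^ 2) / 2) = diagonal e * M := by
    ext i j
    have := he i
    simp only [diagonal_mul, complexify, M, of_apply, map_apply, Complex.ofReal_div]
    rw [mul_div_cancel₀ _ this]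
    simp [g, nutPull, abs_of_pos hu, abs_of_pos hv]
  have hX : matDXi J (u * v) ((v ^ 2 - u ^ 2) / 2)
      = (1 / (2 * ((v : ℂ) + Complex.I * u))) • (diagonal e * (R + diagonal d * M)) := by
    ext i j
    have h1 := he i
    have h2 := two_mul_zeta_mul_dXi (f := fun r z => J r z i j) hu hv
      (differentiableAt_entry hε hnut i j hhalf)
    have h3 : e i * (R i j + d i * M i j) = (partialSnd (g i j) (u, v) : ℂ)
        - Complex.I * (partialFst (g i j) (u, v) : ℂ) := by
      simp only [R, d, M, of_apply]
      push_cast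
      change e i * ((_ / e i - _ * (_ / e i)) - _ * (_ / e i - _ * (_ / e i)) + _ * (_ / e i)) = _
      field_simp
      ring
    rw [Matrix.smul_apply, diagonal_mul, Matrix.add_apply, diagonal_mul, h3, smul_eq_mul]
    rw [show (partialSnd (g i j) (u, v) : ℂ) - Complex.I * (partialFst (g i j) (u, v) : ℂ) = _ from
      h2.symm]
    change matDXi J (u * v) ((v ^ 2 - u ^ 2) / 2) i j = _ * (_ * matDXi J _ _ i j)
    field_simp
  -- `det E = u²v² = r²` cancels against `det J = -r²`.
  have hdet : M.det = -1 := by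
    have h1 : (complexify J (u * v) ((v ^ 2 - u ^ 2) / 2)).det = -((u : ℂ) * v) ^ 2 := by
      have := congrArg (Complex.ofRealHom) (hvac.det_eq _ _ hhalf)
      rw [RingHom.map_det] at this
      exact this.trans (by simp)
    rw [hJ, det_mul, det_diagonal, Fin.prod_univ_three] at h1
    have hu0 : (u : ℂ) ≠ 0 := by exact_mod_cast hu.ne'
    have hv0 : (v : ℂ) ≠ 0 := by exact_mod_cast hv.ne'
    refine mul_left_cancel₀ (mul_ne_zero (pow_ne_zero 2 hu0) (pow_ne_zero 2 hv0)) ?_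
    simp [e, rodScale] at h1
    linear_combination h1
  have hM : ∀ i j, ‖M i j‖ ≤ max C (C + C) := fun i j => by
    simp only [M, of_apply, Complex.norm_real, Real.norm_eq_abs]
    exact (hC u v hu hu' hv hv' i j).1.trans (le_max_left _ _)
  have hR : ∀ i j, ‖R i j‖ ≤ max C (C + C) := fun i j => by
    refine ((norm_sub_le _ _).trans ?_).trans (le_max_right _ _)
    rw [norm_mul, Complex.norm_I, one_mul, Complex.norm_real, Complex.norm_real]
    exact add_le_add (hC u v hu hu' hv hv' i j).2.2 (hC u v hu hu' hv hv' i j).2.1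
  obtain ⟨ha, hb, hc⟩ := hB M R hM hR
  refine ⟨_, _, _, ha, hb, hc, ?_⟩
  rw [hX, hJ]
  simp only [Matrix.mul_smul, Matrix.smul_mul, trace_smul, smul_smul]
  rw [trace_sq_of_factorization he hdet (by simp [d])]
  have hd1 : d 1 = -(Complex.I * (2 / u)) := by simp [d]
  have hd2 : d 2 = 2 / v := by simp [d]
  rw [hd1, hd2, smul_eq_mul, sq (1 / (2 * ((v : ℂ) + Complex.I * u)))]

/-! ### Boundedness of the gradient -/

/-- The logarithm of `(u² + v²) e^{2ν}` as a function of `(u, v)`. -/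
noncomputable def logFactor (ν : ℝ → ℝ → ℝ) (p : ℝ × ℝ) : ℝ :=
  nutPull (fun r z => Real.log (r * Real.exp (2 * ν r z))) p - Real.log p.1 - Real.log p.2
    + Real.log (p.1 ^ 2 + p.2 ^ 2)

lemma differentiableAt_log_conformal {ε : ℝ} {J : KillingMatrix} {ν : ℝ → ℝ → ℝ}
    (hvac : IsWeylVacuum ε J ν) {p : ℝ × ℝ} (hp : p ∈ halfDisc ε) :
    DifferentiableAt ℝ (fun p : ℝ × ℝ => Real.log (p.1 * Real.exp (2 * ν p.1 p.2))) p := by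
  have hopen : IsOpen (halfDisc ε) :=
    (isOpen_lt continuous_const continuous_fst).inter
      (isOpen_lt (f := fun p : ℝ × ℝ => p.1 ^ 2 + p.2 ^ 2) (by fun_prop) continuous_const)
  have hν := hvac.differentiable_nu.differentiableAt (hopen.mem_nhds hp)
  exact (differentiableAt_fst.mul (hν.const_mul 2).exp).log
    (mul_pos hp.1 (Real.exp_pos _)).ne'

lemma uvFactor_eq_exp_logFactor (ν : ℝ → ℝ → ℝ) {r : ℝ} (hr : 0 < r) (z : ℝ) :
    uvFactor ν r z = Real.exp (logFactor ν (nutU r z, nutV r z)) := by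
  have hu := nutU_pos hr z
  have hv := nutV_pos hr z
  have hlog : Real.log (nutU r z) + Real.log (nutV r z) = Real.log r := by
    rw [← Real.log_mul hu.ne' hv.ne', nutU_mul_nutV hr]
  rw [logFactor, nutPull_nutU_nutV _ hr, Real.log_mul hr.ne' (Real.exp_pos _).ne', Real.log_exp,
    uvFactor, ← Real.exp_log (show 0 < nutU r z ^ 2 + nutV r z ^ 2 by positivity), ← Real.exp_add,
    Real.exp_log (by positivity)]
  congr 1
  linarith

/-- `|ζ|` dominates its real part `v` and its imaginary part `u`. -/
lemma norm_div_zeta_le {u v x : ℝ} (hx : 0 ≤ x) (hxu : x ≤ u ∨ x ≤ v) (hu : 0 < u) (hv : 0 < v) :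
    ‖(x : ℂ) / ((v : ℂ) + Complex.I * u)‖ ≤ 1 := by
  rw [norm_div, Complex.norm_real, Real.norm_of_nonneg hx]
  have h1 := Complex.abs_re_le_norm ((v : ℂ) + Complex.I * u)
  have h2 := Complex.abs_im_le_norm ((v : ℂ) + Complex.I * u)
  simp only [Complex.add_re, Complex.ofReal_re, Complex.mul_re, Complex.I_re, Complex.I_im,
    Complex.ofReal_im, Complex.add_im, Complex.mul_im] at h1 h2
  rw [abs_of_pos (by linarith)] at h1 h2
  refine div_le_one_of_le₀ ?_ (norm_nonneg _)
  rcases hxu with h | h <;> linarith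

/-- The gradient of `log ((u² + v²) e^{2ν})` in `(u, v)` is bounded near the nut. -/
lemma exists_gradient_bound {ε ρ : ℝ} (hε : 0 < ε) {J : KillingMatrix} {ν : ℝ → ℝ → ℝ}
    (hvac : IsWeylVacuum ε J ν) (hnut : IsRegularNut ε J) (hρε : ρ ^ 2 < ε) :
    ∃ B, ∀ u v, 0 < u → u < ρ → 0 < v → v < ρ →
      DifferentiableAt ℝ (logFactor ν) (u, v) ∧
      |fderiv ℝ (logFactor ν) (u, v) (1, 0)| ≤ B ∧ |fderiv ℝ (logFactor ν) (u, v) (0, 1)| ≤ B := by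
  obtain ⟨B, hB⟩ := exists_trace_expansion hε hvac hnut hρε
  -- One summand for each of the three terms in `hkey`; in the last one `v < ρ`.
  refine ⟨B + B + ρ / 4 * B, fun u v hu hu' hv hv' => ?_⟩
  obtain ⟨a, b, c, ha, hb, hc, htr⟩ := hB u v hu hu' hv hv'
  have hmem : (u, v) ∈ nutDisc ε :=
    cornerSquare_subset_nutDisc hρε ⟨⟨hu.le, hu'.le⟩, hv.le, hv'.le⟩
  have hhalf := mul_mem_halfDisc hu hv hmem
  have hLd := differentiableAt_log_conformal hvac hhalf
  have hL := two_mul_zeta_mul_dXi (f := fun r z => Real.log (r * Real.exp (2 * ν r z))) hu hv hLd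
  have hLp := differentiableAt_nutPull
    (f := fun r z => Real.log (r * Real.exp (2 * ν r z))) hu hv hLd
  rw [hvac.field_nu _ _ hhalf, htr] at hL
  set L := nutPull fun r z => Real.log (r * Real.exp (2 * ν r z)) with hLdef
  have hw : DifferentiableAt ℝ (logFactor ν) (u, v) := by
    have h1 : DifferentiableAt ℝ (fun p : ℝ × ℝ => Real.log p.1) (u, v) :=
      differentiableAt_fst.log hu.ne'
    have h2 : DifferentiableAt ℝ (fun p : ℝ × ℝ => Real.log p.2) (u, v) :=
      differentiableAt_snd.log hv.ne'
    have h3 : DifferentiableAt ℝ (fun p : ℝ × ℝ => Real.log (p.1 ^ 2 + p.2 ^ 2)) (u, v) :=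
      DifferentiableAt.log (by fun_prop) (show u ^ 2 + v ^ 2 ≠ 0 by positivity)
    exact ((hLp.sub h1).sub h2).add h3
  have hN : u ^ 2 + v ^ 2 ≠ 0 := by positivity
  have hwU : fderiv ℝ (logFactor ν) (u, v) (1, 0)
      = partialFst L (u, v) - 1 / u + 2 * u / (u ^ 2 + v ^ 2) := by
    refine (hasDerivAt_slice_fst hw).unique ?_
    exact ((((hasDerivAt_partialFst hLp).sub ((hasDerivAt_id u).log hu.ne')).sub_const
      (Real.log v)).add (((hasDerivAt_pow 2 u).add_const (v ^ 2)).log hN)).congr_deriv (by simp)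
  have hwV : fderiv ℝ (logFactor ν) (u, v) (0, 1)
      = partialSnd L (u, v) - 1 / v + 2 * v / (u ^ 2 + v ^ 2) := by
    refine (hasDerivAt_slice_snd hw).unique ?_
    exact ((((hasDerivAt_slice_snd hLp).differentiableAt.hasDerivAt.sub_const (Real.log u)).sub
      ((hasDerivAt_id v).log hv.ne')).add
        (((hasDerivAt_pow 2 v).const_add (u ^ 2)).log hN)).congr_deriv (by simp [partialSnd])
  have hζ : (v : ℂ) + Complex.I * u ≠ 0 := fun h => hv.ne' (by simpa using congrArg Complex.re h)
  have hu0 : (u : ℂ) ≠ 0 := by exact_mod_cast hu.ne'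
  have hv0 : (v : ℂ) ≠ 0 := by exact_mod_cast hv.ne'
  have hζ' : (v : ℂ) - Complex.I * u ≠ 0 := fun h => hv.ne' (by simpa using congrArg Complex.re h)
  have hNc : (u : ℂ) ^ 2 + (v : ℂ) ^ 2
      = ((v : ℂ) + Complex.I * u) * ((v : ℂ) - Complex.I * u) := by
    linear_combination ((u : ℂ) ^ 2) * Complex.I_sq
  -- The singular terms cancel by `i(u² - v²)/(uvζ) = 1/v - i/u - 2/ζ`. The prefactor `iuv/(4ζ)`
  -- left from the field equation absorbs the poles `1/u` and `1/v` of the cross terms.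
  have hkey : ((fderiv ℝ (logFactor ν) (u, v) (0, 1) : ℝ) : ℂ)
      - Complex.I * ((fderiv ℝ (logFactor ν) (u, v) (1, 0) : ℝ) : ℂ)
      = -((v : ℂ) / ((v : ℂ) + Complex.I * u)) * a
        - Complex.I * ((u : ℂ) / ((v : ℂ) + Complex.I * u)) * b
        + Complex.I * (v / 4) * ((u : ℂ) / ((v : ℂ) + Complex.I * u)) * c := by
    have h2N : ((2 * v / (u ^ 2 + v ^ 2) : ℝ) : ℂ) - Complex.I * ((2 * u / (u ^ 2 + v ^ 2) : ℝ) : ℂ)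
        = 2 / ((v : ℂ) + Complex.I * u) := by
      push_cast
      rw [hNc]
      field_simp
    rw [hwU, hwV]
    have hsplit : (((partialSnd L (u, v) - 1 / v + 2 * v / (u ^ 2 + v ^ 2) : ℝ)) : ℂ)
        - Complex.I * ((partialFst L (u, v) - 1 / u + 2 * u / (u ^ 2 + v ^ 2) : ℝ) : ℂ)
        = ((partialSnd L (u, v) : ℂ) - Complex.I * (partialFst L (u, v) : ℂ))
          - (1 / v - Complex.I / u) + (((2 * v / (u ^ 2 + v ^ 2) : ℝ) : ℂ)
            - Complex.I * ((2 * u / (u ^ 2 + v ^ 2) : ℝ) : ℂ)) := by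
      push_cast
      ring
    rw [hsplit, h2N, ← hL]
    push_cast
    -- The identity is checked with `i` as an indeterminate, reduced only by `i² = -1` and `i³ =
    -- -i`.
    have hI2 := Complex.I_sq
    have hI3 : Complex.I ^ 3 = -Complex.I := Complex.I_pow_three
    generalize Complex.I = I at *
    field_simp
    ring_nf
    simp only [hI2, hI3]
    ring
  have hnorm : ‖((fderiv ℝ (logFactor ν) (u, v) (0, 1) : ℝ) : ℂ)
      - Complex.I * ((fderiv ℝ (logFactor ν) (u, v) (1, 0) : ℝ) : ℂ)‖ ≤ B + B + ρ / 4 * B := by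
    have hB0 : 0 ≤ B := (norm_nonneg a).trans ha
    have hvζ := norm_div_zeta_le hv.le (Or.inr le_rfl) hu hv
    have huζ := norm_div_zeta_le hu.le (Or.inl le_rfl) hu hv
    have hv4 : ‖(v : ℂ) / 4‖ ≤ ρ / 4 := by
      rw [norm_div, Complex.norm_real, Real.norm_of_nonneg hv.le]
      norm_num
      linarith
    rw [hkey]
    refine (norm_add_le _ _).trans (add_le_add ((norm_sub_le _ _).trans (add_le_add ?_ ?_)) ?_)
    · rw [norm_mul, norm_neg]
      exact (mul_le_mul hvζ ha (norm_nonneg _) zero_le_one).trans_eq (one_mul B)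
    · rw [norm_mul, norm_mul, Complex.norm_I, one_mul]
      exact (mul_le_mul huζ hb (norm_nonneg _) zero_le_one).trans_eq (one_mul B)
    · rw [norm_mul, norm_mul, norm_mul, Complex.norm_I, one_mul]
      refine mul_le_mul ?_ hc (norm_nonneg _) (by linarith)
      exact (mul_le_mul hv4 huζ (norm_nonneg _) (by linarith)).trans_eq (mul_one _)
  refine ⟨hw, ?_, ?_⟩
  · refine le_trans ?_ ((Complex.abs_im_le_norm _).trans hnorm)
    simp
  · refine le_trans ?_ ((Complex.abs_re_le_norm _).trans hnorm)
    simp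

/-! ### Extension to the axis and conclusion -/

/-- `log ((u² + v²) e^{2ν})` extends to a continuous function on the whole plane. -/
lemma exists_continuous_extension {ε ρ : ℝ} (hε : 0 < ε) {J : KillingMatrix} {ν : ℝ → ℝ → ℝ}
    (hvac : IsWeylVacuum ε J ν) (hnut : IsRegularNut ε J) (hρε : ρ ^ 2 < ε) :
    ∃ W : ℝ × ℝ → ℝ, Continuous W ∧
      ∀ u v, 0 < u → u < ρ → 0 < v → v < ρ → logFactor ν (u, v) = W (u, v) := by
  obtain ⟨B, hB⟩ := exists_gradient_bound hε hvac hnut hρε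
  -- The open square is convex, so a gradient bound gives a Lipschitz bound. The norm on `ℝ × ℝ` is
  -- the maximum norm, so the two partial derivatives contribute `B` each.
  have hlip : LipschitzOnWith (B + B).toNNReal (logFactor ν) (Set.Ioo 0 ρ ×ˢ Set.Ioo 0 ρ) := by
    refine ((convex_Ioo 0 ρ).prod (convex_Ioo 0 ρ)).lipschitzOnWith_of_nnnorm_hasFDerivWithin_le
      (f' := fderiv ℝ (logFactor ν)) (fun p hp => ?_) (fun p hp => ?_)
    · exact (hB p.1 p.2 hp.1.1 hp.1.2 hp.2.1 hp.2.2).1.hasFDerivAt.hasFDerivWithinAt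
    · obtain ⟨-, h1, h2⟩ := hB p.1 p.2 hp.1.1 hp.1.2 hp.2.1 hp.2.2
      have hB0 : 0 ≤ B := (abs_nonneg _).trans h1
      rw [← NNReal.coe_le_coe, coe_nnnorm, Real.coe_toNNReal _ (add_nonneg hB0 hB0)]
      refine ContinuousLinearMap.opNorm_le_bound _ (add_nonneg hB0 hB0) fun q => ?_
      have hq : q = q.1 • ((1, 0) : ℝ × ℝ) + q.2 • ((0, 1) : ℝ × ℝ) := by
        ext <;> simp
      have hq1 := norm_fst_le q
      have hq2 := norm_snd_le q
      conv_lhs => rw [hq]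
      rw [map_add, map_smul, map_smul, add_mul]
      refine (norm_add_le _ _).trans (add_le_add ?_ ?_)
      · rw [norm_smul, mul_comm]
        exact mul_le_mul h1 hq1 (norm_nonneg _) hB0
      · rw [norm_smul, mul_comm]
        exact mul_le_mul h2 hq2 (norm_nonneg _) hB0
  obtain ⟨W, hW, hEq⟩ := hlip.extend_real
  exact ⟨W, hW.continuous, fun u v hu hu' hv hv' => hEq ⟨⟨hu, hu'⟩, hv, hv'⟩⟩

lemma continuous_nutU_nutV : Continuous fun p : ℝ × ℝ => (nutU p.1 p.2, nutV p.1 p.2) := by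
  unfold nutU nutV
  fun_prop

lemma nutU_nutV_zero_lt {ρ δ z : ℝ} (hρ : 0 < ρ) (hδ : 2 * δ ≤ ρ ^ 2) (hz : |z| < δ) :
    nutU 0 z < ρ ∧ nutV 0 z < ρ := by
  have h : √((0 : ℝ) ^ 2 + z ^ 2) = |z| := by
    rw [zero_pow two_ne_zero, zero_add, Real.sqrt_sq_eq_abs]
  rw [nutU, nutV, h, Real.sqrt_lt' hρ, Real.sqrt_lt' hρ]
  constructor <;> linarith [neg_abs_le z, le_abs_self z]

theorem mainTheorem4 (ε : ℝ) (hε : 0 < ε) (J : KillingMatrix) (ν : ℝ → ℝ → ℝ)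
    (hvac : IsWeylVacuum ε J ν) (hnut : IsRegularNut ε J) :
    ∃ δ : ℝ, 0 < δ ∧ δ ≤ ε ∧ ∃ F : ℝ → ℝ,
      (∀ z : ℝ, 0 < |z| → |z| < δ →
        Tendsto (fun p : ℝ × ℝ => uvFactor ν p.1 p.2)
          (𝓝[{p : ℝ × ℝ | 0 < p.1}] ((0 : ℝ), z)) (𝓝 (F z))) ∧
      (∀ z ∈ Set.Ioo (-δ) δ, 0 < F z) ∧
      ContinuousOn F (Set.Ioo (-δ) δ) ∧ ContinuousAt F 0 := by
  -- Any `ρ > 0` with `ρ² < ε` keeps the closed square inside the disc `u² + v² < 2ε`.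
  set ρ := √(ε / 2) with hρdef
  have hρ : 0 < ρ := Real.sqrt_pos.2 (by linarith)
  have hρsq : ρ ^ 2 = ε / 2 := Real.sq_sqrt (by linarith)
  obtain ⟨W, hW, hEq⟩ := exists_continuous_extension hε hvac hnut (show ρ ^ 2 < ε by linarith)
  have hcont : Continuous fun p : ℝ × ℝ => Real.exp (W (nutU p.1 p.2, nutV p.1 p.2)) :=
    Real.continuous_exp.comp (hW.comp continuous_nutU_nutV)
  have hF : Continuous fun z : ℝ => Real.exp (W (nutU 0 z, nutV 0 z)) :=
    hcont.comp (continuous_const.prodMk continuous_id)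
  -- On the axis `u²` and `v²` are at most `2|z|`, so `|z| < ε/4` gives `u, v < ρ`.
  refine ⟨ε / 4, by linarith, by linarith, fun z => Real.exp (W (nutU 0 z, nutV 0 z)),
    fun z _ hz => ?_, fun _ _ => Real.exp_pos _, hF.continuousOn, hF.continuousAt⟩
  have hlt := nutU_nutV_zero_lt hρ (by linarith) hz
  have hnear : ∀ᶠ p : ℝ × ℝ in 𝓝 (0, z), nutU p.1 p.2 < ρ ∧ nutV p.1 p.2 < ρ :=
    ((continuous_fst.comp continuous_nutU_nutV).continuousAt.eventually (gt_mem_nhds hlt.1)).and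
      ((continuous_snd.comp continuous_nutU_nutV).continuousAt.eventually (gt_mem_nhds hlt.2))
  refine (hcont.tendsto (0, z)).mono_left nhdsWithin_le_nhds |>.congr' ?_
  filter_upwards [self_mem_nhdsWithin, nhdsWithin_le_nhds hnear] with p hp hpρ
  rw [uvFactor_eq_exp_logFactor ν hp,
    hEq _ _ (nutU_pos hp _) hpρ.1 (nutV_pos hp _) hpρ.2]
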